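/- An online path is built as follows. $G_0$ is the graph with a single vertex $v_0$. In step $t\ge 1$ a new vertex $v_t$ arrives and the path $G_{t-1}$ on $\{v_0,\dots,v_{t-1}\}$ is changed into a path $G_t$ on $\{v_0,\dots,v_t\}$ in one of two ways: either $v_t$ is appended at an end of $G_{t-1}$ (joined to that end by an edge), or $v_t$ subdivides an edge $ab$ of $G_{t-1}$ (the edge $ab$ is deleted and the edges $av_t$ and $v_tb$ are added). The process may stop after finitely many steps or go on forever. A vertex coloring of a graph is nonrepetitive if there is no path $u_1,\dots,u_{2l}$ with $l\ge 1$ in the graph such that $u_i$ and $u_{i+l}$ have the same color for all $1\le i\le l$. Theorem. Using $12$ colors one can color online nonrepetitively any path. That is, there is a strategy that assigns to each vertex $v_t$, on its arrival, one of $12$ colors, depending only on $G_0,\dots,G_t$ (and the colors already given), such that no vertex is ever recolored and, however the online path is built, at every time $t$ the coloring of $\{v_0,\dots,v_t\}$ is a nonrepetitive coloring of $G_t$. -/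

import Mathlib

/-- A finite sequence is a repetition if it has the form `x₁ … x_l x₁ … x_l` with `l ≥ 1`. -/
def IsRepetition {α : Type*} (s : List α) : Prop :=
  ∃ w : List α, w ≠ [] ∧ s = w ++ w

/-- A coloring `c` of the vertices of `G` is nonrepetitive if along no path of `G` the sequence
of colors is a repetition. -/
def IsNonrepetitiveColoring {V α : Type*} (G : SimpleGraph V) (c : V → α) : Prop :=
  ∀ (u v : V) (p : G.Walk u v), p.IsPath → ¬ IsRepetition (p.support.map c)

/-- The step of the online process. The old graph has vertices `v₀, …, v_t` (the elements of
`Fin (t + 1)`). A new vertex `v_{t+1}` (`Fin.last (t + 1)`) arrives, is joined to the old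
vertices in `D`, and the old edges in `C` are deleted. -/
def nextGraph {t : ℕ} (G : SimpleGraph (Fin (t + 1))) (D : Set (Fin (t + 1)))
    (C : Set (Sym2 (Fin (t + 1)))) : SimpleGraph (Fin (t + 1 + 1)) :=
  SimpleGraph.fromEdgeSet
    ((Sym2.map Fin.castSucc '' G.edgeSet ∪ (fun d => s(Fin.last (t + 1), Fin.castSucc d)) '' D) \
      (Sym2.map Fin.castSucc '' C))

/-- A restriction on the moves `D`, `C` that are allowed when the current graph is `G`. -/
def OnlineRestriction : Type :=
  ∀ t : ℕ, SimpleGraph (Fin (t + 1)) → Set (Fin (t + 1)) → Set (Sym2 (Fin (t + 1))) → Prop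

/-- `G 0, G 1, …` (up to `G N`, where `N = ⊤` means that the process never stops) is generated
by moves obeying the restriction `R`. The graph `G 0` is the graph with the single vertex `v₀`,
the only graph on `Fin 1`; the values of `G` beyond `N` are irrelevant. -/
def IsOnlineProcess (R : OnlineRestriction) (N : ℕ∞) (G : ∀ t : ℕ, SimpleGraph (Fin (t + 1))) :
    Prop :=
  ∀ t : ℕ, ((t + 1 : ℕ) : ℕ∞) ≤ N →
    ∃ (D : Set (Fin (t + 1))) (C : Set (Sym2 (Fin (t + 1)))),
      C ⊆ (G t).edgeSet ∧ R t (G t) D C ∧ G (t + 1) = nextGraph (G t) D C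

/-- A deterministic online coloring strategy: the color of `v_t` is a function of the graphs
`G₀, …, G_t` seen so far. (The earlier colors are themselves determined by this history.) -/
def OnlineStrategy (α : Type*) : Type _ :=
  ∀ t : ℕ, (∀ s : Fin (t + 1), SimpleGraph (Fin (s.val + 1))) → α

/-- The coloring of `v₀, …, v_t` produced by a strategy on the process `G`: each vertex `v_s` was
colored on its arrival, knowing only `G₀, …, G_s`, and keeps its color. -/
def OnlineStrategy.coloring {α : Type*} (σ : OnlineStrategy α)
    (G : ∀ t : ℕ, SimpleGraph (Fin (t + 1))) (t : ℕ) : Fin (t + 1) → α :=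
  fun s => σ s.val (fun i => G i.val)

/-- With `k` colors one can color nonrepetitively online any graph that can be generated
according to `R`: one strategy keeps, in every finite or infinite process obeying `R`, the
coloring of the current graph nonrepetitive at all times. -/
def OnlineNonrepetitivelyColorable (R : OnlineRestriction) (k : ℕ) : Prop :=
  ∃ σ : OnlineStrategy (Fin k), ∀ (N : ℕ∞) (G : ∀ t : ℕ, SimpleGraph (Fin (t + 1))),
    IsOnlineProcess R N G →
      ∀ t : ℕ, (t : ℕ∞) ≤ N → IsNonrepetitiveColoring (G t) (σ.coloring G t)

/-- The restriction defining online paths: the current graph is a path, and the new vertex is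
either appended at an end of the path (a vertex with at most one neighbor; for a single vertex,
that vertex) or subdivides an edge `ab` of the path. -/
def onlinePath : OnlineRestriction := fun t G D C =>
  Nonempty (G ≃g SimpleGraph.pathGraph (t + 1)) ∧
    ((∃ e : Fin (t + 1), (G.neighborSet e).Subsingleton ∧ D = {e} ∧ C = ∅) ∨
      (∃ a b : Fin (t + 1), G.Adj a b ∧ D = {a, b} ∧ C = {s(a, b)}))

/-!
# Online nonrepetitive coloring of paths with 12 colors

The first vertex has level `0`. A new vertex gets one more than the least level of its neighbors
on arrival. Then adjacent vertices always have levels that differ by at most one. Consider the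
vertices of level `i` between two consecutive vertices of level less than `i`. A vertex inserted
between two vertices of level at least `i` has a level greater than `i`; so such a run of vertices
of level `i` grows only at its two ends, and its members can be numbered by consecutive integers,
once and for all. The color of a vertex is a pair: the letter that its level selects in a
square-free sequence on four letters without subwords `aba` (`spacedThue`), and the letter that its
number in the run selects in a two-sided square-free sequence on three letters (`ternaryThue`).
This makes `4 * 3 = 12` colors.

Along a path the levels form a lazy walk on `ℤ`. If the colors form a repetition, then so do the
levels themselves (`walk_repeats`); in particular the vertices of minimal level occur at the same
places in both halves. These vertices belong to one run and are consecutive in it, so that their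
second letters form a square in `ternaryThue`, which is impossible
(`IsLayered.color_ne_of_increasing`).

The order of the vertices on the path is recorded by rational coordinates. `IsLayered` collects the
invariants of the labels, and `IsLayered.exists_extend` says that every move admits a label for the
new vertex that preserves them.
-/

/-! ### Square-free two-sided sequences -/

/-- A two-sided sequence without two adjacent equal blocks. -/
def IsSquareFreeSeq {α : Type*} (s : ℤ → α) : Prop :=
  ∀ i p : ℤ, 0 < p → ∃ k, i ≤ k ∧ k < i + p ∧ s k ≠ s (k + p)

/-- The Thue–Morse sequence: the parity of the number of binary digits `1` of `n`. -/
def thueMorse (n : ℕ) : Bool := Nat.binaryRec false (fun b _ r => b ^^ r) n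

theorem thueMorse_two_mul (n : ℕ) : thueMorse (2 * n) = thueMorse n := by
  have := Nat.binaryRec_eq (motive := fun _ => Bool) (zero := false)
    (bit := fun b _ r => b ^^ r) false n (Or.inl rfl)
  simpa [thueMorse, Nat.bit] using this

theorem thueMorse_two_mul_add_one (n : ℕ) : thueMorse (2 * n + 1) = !thueMorse n := by
  have := Nat.binaryRec_eq (motive := fun _ => Bool) (zero := false)
    (bit := fun b _ r => b ^^ r) true n (Or.inl rfl)
  simpa [thueMorse, Nat.bit] using this

/-- The two two-sided Thue–Morse sequences. The value at `-1 - n` is that at `n`, complemented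
if `b` is `true`. The doubling substitution exchanges the two sequences, so that they have to
be treated together. -/
def twoSidedThueMorse (b : Bool) : ℤ → Bool
  | Int.ofNat n => thueMorse n
  | Int.negSucc n => thueMorse n ^^ b

theorem twoSidedThueMorse_two_mul (b : Bool) (n : ℤ) :
    twoSidedThueMorse b (2 * n) = twoSidedThueMorse (!b) n := by
  cases n with
  | ofNat n =>
    rw [show 2 * Int.ofNat n = Int.ofNat (2 * n) by simp]
    exact thueMorse_two_mul n
  | negSucc n =>
    rw [show 2 * Int.negSucc n = Int.negSucc (2 * n + 1) by omega]
    simp [twoSidedThueMorse, thueMorse_two_mul_add_one]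

theorem twoSidedThueMorse_two_mul_add_one (b : Bool) (n : ℤ) :
    twoSidedThueMorse b (2 * n + 1) = !twoSidedThueMorse (!b) n := by
  cases n with
  | ofNat n =>
    rw [show 2 * Int.ofNat n + 1 = Int.ofNat (2 * n + 1) by simp]
    exact thueMorse_two_mul_add_one n
  | negSucc n =>
    rw [show 2 * Int.negSucc n + 1 = Int.negSucc (2 * n) by omega]
    simp [twoSidedThueMorse, thueMorse_two_mul]

theorem twoSidedThueMorse_succ_of_even (b : Bool) {n : ℤ} (hn : n % 2 = 0) :
    twoSidedThueMorse b (n + 1) = !twoSidedThueMorse b n := by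
  obtain ⟨k, rfl⟩ : ∃ k, n = 2 * k := ⟨n / 2, by omega⟩
  rw [twoSidedThueMorse_two_mul_add_one, twoSidedThueMorse_two_mul]

/-- The two-sided Thue–Morse sequences are overlap-free. An overlap of even period is halved;
an overlap of odd period would force the sequence to alternate over an odd distance. -/
theorem twoSidedThueMorse_overlapFree (p : ℕ) (hp : 0 < p) : ∀ (b : Bool) (i : ℤ),
    ∃ k, i ≤ k ∧ k ≤ i + p ∧ twoSidedThueMorse b k ≠ twoSidedThueMorse b (k + p) := by
  induction p using Nat.strong_induction_on with
  | _ p ih =>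
    intro b i
    by_contra! h
    rcases Nat.even_or_odd' p with ⟨q, rfl | rfl⟩
    · obtain ⟨k, hk1, hk2, hk⟩ := ih q (by omega) (by omega) (!b) (i / 2)
      apply hk
      rcases Int.emod_two_eq_zero_or_one i with hi | hi
      · have := h (2 * k) (by omega) (by push_cast; omega)
        rw [twoSidedThueMorse_two_mul,
          show 2 * k + ((2 * q : ℕ) : ℤ) = 2 * (k + q) by push_cast; ring,
          twoSidedThueMorse_two_mul] at this
        exact this
      · have := h (2 * k + 1) (by omega) (by push_cast; omega)
        rw [twoSidedThueMorse_two_mul_add_one,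
          show 2 * k + 1 + ((2 * q : ℕ) : ℤ) = 2 * (k + q) + 1 by push_cast; ring,
          twoSidedThueMorse_two_mul_add_one] at this
        simpa using this
    · have alt : ∀ k, i ≤ k → k < i + (2 * q + 1 : ℕ) →
          twoSidedThueMorse b (k + 1) = !twoSidedThueMorse b k := by
        intro k hk1 hk2
        rcases Int.emod_two_eq_zero_or_one k with hk | hk
        · exact twoSidedThueMorse_succ_of_even b hk
        · rw [h k hk1 (by omega), h (k + 1) (by omega) (by omega),
            show k + 1 + ((2 * q + 1 : ℕ) : ℤ) = k + (2 * q + 1 : ℕ) + 1 by ring]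
          exact twoSidedThueMorse_succ_of_even b (by push_cast; omega)
      have even : ∀ r : ℕ, r ≤ q → twoSidedThueMorse b (i + 2 * r) = twoSidedThueMorse b i := by
        intro r
        induction r with
        | zero => simp
        | succ r ihr =>
          intro hr
          rw [← ihr (by omega), show i + 2 * ((r + 1 : ℕ) : ℤ) = i + 2 * r + 1 + 1 by
            push_cast; ring, alt _ (by omega) (by push_cast; omega),
            alt _ (by omega) (by push_cast; omega), Bool.not_not]
      have h0 := h i le_rfl (by omega)
      rw [show i + ((2 * q + 1 : ℕ) : ℤ) = i + 2 * q + 1 by push_cast; ring,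
        alt _ (by omega) (by push_cast; omega), even q le_rfl] at h0
      simp at h0

/-- The ternary Thue sequence: the differences of the Thue–Morse sequence, with `2` for `-1`. -/
def ternaryThue (n : ℤ) : Fin 3 :=
  match twoSidedThueMorse false n, twoSidedThueMorse false (n + 1) with
  | false, true => 1
  | true, false => 2
  | _, _ => 0

/-- A square of period `p` among the differences makes `t (k + p) - t k` constant on a block of
length `p + 1`; the constant is `0`, whence an overlap. -/
theorem isSquareFreeSeq_ternaryThue : IsSquareFreeSeq ternaryThue := by
  intro i p hp
  lift p to ℕ using hp.le
  by_contra! h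
  set t := twoSidedThueMorse false with ht
  have key : ∀ r : ℕ, r ≤ p → (t (i + r) = t (i + r + p) ↔ t i = t (i + p)) ∧
      (t i ≠ t (i + p) → t (i + r) = t i) := by
    intro r
    induction r with
    | zero => simp
    | succ r ihr =>
      intro hr
      have h1 := ihr (by omega)
      have h2 := h (i + r) (by omega) (by omega)
      simp only [ternaryThue, ← ht] at h2
      rw [show i + ((r + 1 : ℕ) : ℤ) = i + r + 1 by push_cast; ring,
        show i + (r : ℤ) + 1 + p = i + r + p + 1 by ring]
      revert h1 h2
      generalize t (i + r) = a
      generalize t (i + r + p) = b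
      generalize t (i + r + 1) = c
      generalize t (i + r + p + 1) = d
      generalize t i = e
      generalize t (i + p) = f
      revert a b c d e f
      decide
  by_cases h0 : t i = t (i + p)
  · obtain ⟨k, hk1, hk2, hk⟩ := twoSidedThueMorse_overlapFree p (by omega) false i
    have := (key (k - i).toNat (by omega)).1.2 h0
    rw [show i + ((k - i).toNat : ℤ) = k by omega] at this
    exact hk this
  · exact h0 ((key p le_rfl).2 h0).symm

/-- The ternary Thue sequence, cut into blocks of length two that are separated by a fourth
letter. This destroys the palindromes of length three. -/
def spacedThue (n : ℤ) : Fin 4 :=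
  if n % 3 = 2 then 3 else (ternaryThue (2 * (n / 3) + n % 3)).castSucc

theorem spacedThue_sep (n : ℤ) : spacedThue (3 * n + 2) = 3 := by
  rw [spacedThue, if_pos (by omega)]

theorem spacedThue_fst (n : ℤ) : spacedThue (3 * n) = (ternaryThue (2 * n)).castSucc := by
  rw [spacedThue, if_neg (by omega)]
  congr 2; omega

theorem spacedThue_snd (n : ℤ) : spacedThue (3 * n + 1) = (ternaryThue (2 * n + 1)).castSucc := by
  rw [spacedThue, if_neg (by omega)]
  congr 2; omega

theorem ternaryThue_ne_succ (n : ℤ) : ternaryThue n ≠ ternaryThue (n + 1) := by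
  obtain ⟨k, h1, h2, h3⟩ := isSquareFreeSeq_ternaryThue n 1 one_pos
  rwa [show k = n by omega] at h3

theorem castSucc_ne_three (c : Fin 3) : c.castSucc ≠ (3 : Fin 4) := by
  revert c; decide

/-- Letters of `spacedThue` at distance at most two are distinct: neither `aa` nor `aba` occurs. -/
theorem spacedThue_injOn_near {a b : ℤ} (h : |a - b| ≤ 2) (hab : spacedThue a = spacedThue b) :
    a = b := by
  wlog hle : a ≤ b generalizing a b
  · exact (this (by rwa [abs_sub_comm]) hab.symm (by omega)).symm
  rw [abs_le] at h
  have hT (n : ℤ) : ternaryThue (2 * n + 1) ≠ ternaryThue (2 * (n + 1)) := by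
    rw [show 2 * (n + 1) = 2 * n + 1 + 1 by ring]
    exact ternaryThue_ne_succ _
  obtain ⟨n, rfl | rfl | rfl⟩ : ∃ n, a = 3 * n ∨ a = 3 * n + 1 ∨ a = 3 * n + 2 :=
    ⟨a / 3, by omega⟩
  · obtain rfl | rfl | rfl : b = 3 * n ∨ b = 3 * n + 1 ∨ b = 3 * n + 2 := by omega
    · rfl
    · rw [spacedThue_fst, spacedThue_snd, Fin.castSucc_inj] at hab
      exact absurd hab (ternaryThue_ne_succ _)
    · rw [spacedThue_fst, spacedThue_sep] at hab
      exact absurd hab (castSucc_ne_three _)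
  · obtain rfl | rfl | rfl : b = 3 * n + 1 ∨ b = 3 * n + 2 ∨ b = 3 * (n + 1) := by omega
    · rfl
    · rw [spacedThue_snd, spacedThue_sep] at hab
      exact absurd hab (castSucc_ne_three _)
    · rw [spacedThue_snd, spacedThue_fst, Fin.castSucc_inj] at hab
      exact absurd hab (hT _)
  · obtain rfl | rfl | rfl : b = 3 * n + 2 ∨ b = 3 * (n + 1) ∨ b = 3 * (n + 1) + 1 := by omega
    · rfl
    · rw [spacedThue_sep, spacedThue_fst] at hab
      exact absurd hab.symm (castSucc_ne_three _)
    · rw [spacedThue_sep, spacedThue_snd] at hab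
      exact absurd hab.symm (castSucc_ne_three _)

/-- A square of period at least three shows that its period is a multiple of three, by the
positions of the separators, and erasing them leaves a square of the ternary Thue sequence. -/
theorem isSquareFreeSeq_spacedThue : IsSquareFreeSeq spacedThue := by
  intro i p hp
  by_contra! h
  by_cases hp2 : p ≤ 2
  · have := spacedThue_injOn_near (by rw [abs_le]; constructor <;> omega) (h i le_rfl (by omega))
    omega
  obtain ⟨q, rfl⟩ : ∃ q, p = 3 * q := by
    obtain ⟨k, hk1, hk2⟩ : ∃ k, i ≤ 3 * k + 2 ∧ 3 * k + 2 < i + 3 := ⟨i / 3, by omega⟩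
    have h1 := h _ hk1 (by omega)
    rw [spacedThue_sep, spacedThue] at h1
    split_ifs at h1 with h2
    · exact ⟨p / 3, by omega⟩
    · exact absurd h1.symm (castSucc_ne_three _)
  -- `2 * (i / 3) + i % 3` counts the letters other than separators in front of `i`.
  obtain ⟨j, hj1, hj2, hj⟩ :=
    isSquareFreeSeq_ternaryThue (2 * (i / 3) + i % 3) (2 * q) (by omega)
  obtain ⟨c, rfl | rfl⟩ := Int.even_or_odd' j
  · have := h (3 * c) (by omega) (by omega)
    rw [← mul_add, spacedThue_fst, spacedThue_fst, Fin.castSucc_inj, mul_add] at this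
    exact hj this
  · have := h (3 * c + 1) (by omega) (by omega)
    rw [show 3 * c + 1 + 3 * q = 3 * (c + q) + 1 by ring, spacedThue_snd, spacedThue_snd,
      Fin.castSucc_inj, show 2 * (c + q) + 1 = 2 * c + 1 + 2 * q by ring] at this
    exact hj this

/-! ### Lazy walks on the integers -/

theorem exists_eq_of_le_of_le {l : ℕ → ℤ} {n : ℕ} (hl : ∀ j < n, |l (j + 1) - l j| ≤ 1) {v : ℤ}
    (h0 : l 0 ≤ v) (hn : v ≤ l n) : ∃ j ≤ n, l j = v := by
  induction n with
  | zero => exact ⟨0, le_rfl, le_antisymm h0 hn⟩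
  | succ n ih =>
    by_cases h : v ≤ l n
    · obtain ⟨j, hj, rfl⟩ := ih (fun j hj => hl j (by omega)) h
      exact ⟨j, by omega, rfl⟩
    · have := abs_le.1 (hl n (by omega))
      exact ⟨n + 1, le_rfl, by omega⟩

theorem exists_eq_of_ge_of_ge {l : ℕ → ℤ} {n : ℕ} (hl : ∀ j < n, |l (j + 1) - l j| ≤ 1) {v : ℤ}
    (h0 : v ≤ l 0) (hn : l n ≤ v) : ∃ j ≤ n, l j = v := by
  obtain ⟨j, hj, h⟩ := exists_eq_of_le_of_le (l := fun j => -l j) (n := n) (v := -v)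
    (fun j hj => by
      rw [show -l (j + 1) - -l j = -(l (j + 1) - l j) by ring, abs_neg]; exact hl j hj)
    (by simpa using h0) (by simpa using hn)
  exact ⟨j, hj, by simpa using h⟩

/-- Two lazy walks that see the same letters of a sequence without `aa` and `aba` move in
parallel or as mirror images. The alternative `∃ ε s c` remembers, in the letters at distance `s`,
which of the two it is; this is not yet decided while the walks stand still. -/
theorem walk_parallel_or_mirrored {α : Type*} {S : ℤ → α}
    (hS : ∀ a b, |a - b| ≤ 2 → S a = S b → a = b) {l : ℕ → ℤ} {m : ℕ}
    (hl : ∀ j, j + 1 < 2 * m → |l (j + 1) - l j| ≤ 1)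
    (hc : ∀ j < m, S (l j) = S (l (j + m))) (n : ℕ) (hn : n < m) :
    (∀ j ≤ n, l j = l 0 ∧ l (j + m) = l m) ∨
      ∃ ε s c : ℤ, (ε = 1 ∨ ε = -1) ∧ (s = 1 ∨ s = -1) ∧ (∀ j ≤ n, l (j + m) = ε * l j + c) ∧
        S (l n + s) = S (l (n + m) + ε * s) := by
  induction n with
  | zero => left; intro j hj; obtain rfl : j = 0 := by omega
            simp
  | succ n ih =>
    have hp := abs_le.1 (hl n (by omega))
    have hq := hl (n + m) (by omega)
    rw [show n + m + 1 = n + 1 + m by ring] at hq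
    replace hq := abs_le.1 hq
    have c0 := hc n (by omega)
    have c1 := hc (n + 1) hn
    have hS' : ∀ a b, -2 ≤ a - b → a - b ≤ 2 → S a = S b → a = b :=
      fun a b h1 h2 => hS a b (abs_le.2 ⟨h1, h2⟩)
    have ih := ih (by omega)
    by_cases hd : l (n + 1) = l n
    · have hd' : l (n + 1 + m) = l (n + m) := by
        refine hS' _ _ (by omega) (by omega) ?_
        rw [← c1, ← c0, hd]
      rcases ih with ih | ⟨ε, s, c, hε, hs, hj, hcol⟩
      · left
        intro j hjn
        rcases Nat.lt_or_ge n j with h | h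
        · obtain rfl : j = n + 1 := by omega
          rw [hd, hd']
          exact ih n le_rfl
        · exact ih j h
      · refine Or.inr ⟨ε, s, c, hε, hs, ?_, by rw [hd, hd']; exact hcol⟩
        intro j hjn
        rcases Nat.lt_or_ge n j with h | h
        · obtain rfl : j = n + 1 := by omega
          rw [hd, hd']
          exact hj n le_rfl
        · exact hj j h
    · have hd' : l (n + 1 + m) ≠ l (n + m) := by
        intro h
        refine hd (hS' _ _ (by omega) (by omega) ?_)
        rw [c1, c0, h]
      obtain ⟨d, hd0, hdl⟩ : ∃ d : ℤ, (d = 1 ∨ d = -1) ∧ l (n + 1) = l n + d :=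
        ⟨l (n + 1) - l n, by omega, by omega⟩
      obtain ⟨d', hd0', hdl'⟩ : ∃ d : ℤ, (d = 1 ∨ d = -1) ∧ l (n + 1 + m) = l (n + m) + d :=
        ⟨l (n + 1 + m) - l (n + m), by omega, by omega⟩
      right
      rcases ih with ih | ⟨ε, s, c, hε, hs, hj, hcol⟩
      · refine ⟨d * d', -d, l m - d * d' * l 0, ?_, by omega, ?_, ?_⟩
        · rcases hd0 with rfl | rfl <;> rcases hd0' with rfl | rfl <;> simp
        · intro j hjn
          rcases Nat.lt_or_ge n j with h | h
          · obtain rfl : j = n + 1 := by omega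
            rw [hdl', hdl, (ih n le_rfl).1, (ih n le_rfl).2]
            rcases hd0 with rfl | rfl <;> ring
          · rw [(ih j h).1, (ih j h).2]; ring
        · rw [hdl, hdl', show l n + d + -d = l n by ring,
            show l (n + m) + d' + d * d' * -d = l (n + m) by
              rcases hd0 with rfl | rfl <;> ring]
          exact c0
      · rw [hdl, hdl'] at c1
        have hdd : d' = ε * d := by
          by_cases hds : d = s
          · subst hds
            have := hS' (l (n + m) + d') (l (n + m) + ε * d)
              (by rcases hε with rfl | rfl <;> omega) (by rcases hε with rfl | rfl <;> omega)
              (by rw [← c1, hcol])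
            omega
          · by_contra hne
            have e : d' = ε * s := by rcases hε with rfl | rfl <;> omega
            have := hS' (l n + d) (l n + s) (by omega) (by omega) (by rw [c1, hcol, e])
            omega
        refine ⟨ε, -d, c, hε, by omega, ?_, ?_⟩
        · intro j hjn
          rcases Nat.lt_or_ge n j with h | h
          · obtain rfl : j = n + 1 := by omega
            rw [hdl', hdl, hj n le_rfl, hdd]; ring
          · exact hj j h
        · rw [hdl, hdl', hdd, show l n + d + -d = l n by ring,
            show l (n + m) + ε * d + ε * -d = l (n + m) by ring]
          exact c0

/-- If a lazy walk reads a repetition along a square-free sequence without `aba`, then the walk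
itself, and not only its sequence of letters, is a repetition. -/
theorem walk_repeats {α : Type*} {S : ℤ → α} (hsq : IsSquareFreeSeq S)
    (hS : ∀ a b, |a - b| ≤ 2 → S a = S b → a = b) {l : ℕ → ℤ} {m : ℕ}
    (hl : ∀ j, j + 1 < 2 * m → |l (j + 1) - l j| ≤ 1)
    (hc : ∀ j < m, S (l j) = S (l (j + m))) (j : ℕ) (hj : j < m) : l j = l (j + m) := by
  have hl' : ∀ j < m, |l (j + 1) - l j| ≤ 1 := fun j hj => hl j (by omega)
  -- By determinism, one coincidence of the two halves is enough.
  have prop : ∀ n < m, l n = l (n + m) ↔ l 0 = l m := by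
    intro n
    induction n with
    | zero => simp
    | succ n ih =>
      intro hn
      rw [← ih (by omega)]
      have hp := abs_le.1 (hl n (by omega))
      have hq := hl (n + m) (by omega)
      rw [show n + m + 1 = n + 1 + m by ring] at hq
      replace hq := abs_le.1 hq
      constructor <;> intro h
      · exact hS _ _ (abs_le.2 ⟨by omega, by omega⟩) (hc n (by omega))
      · exact hS _ _ (abs_le.2 ⟨by omega, by omega⟩) (hc (n + 1) hn)
  suffices h : ∃ n < m, |l n - l (n + m)| ≤ 2 by
    obtain ⟨n, hn, h⟩ := h
    exact (prop j hj).2 ((prop n hn).1 (hS _ _ h (hc n hn)))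
  rcases walk_parallel_or_mirrored hS hl hc (m - 1) (by omega) with h | ⟨ε, s, c, hε, -, h, -⟩
  · have h1 := (h (m - 1) le_rfl).1
    have h2 := abs_le.1 (hl' (m - 1) (by omega))
    rw [show m - 1 + 1 = m by omega] at h2
    exact ⟨0, by omega, abs_le.2 ⟨by rw [zero_add]; omega, by rw [zero_add]; omega⟩⟩
  replace h : ∀ j < m, l (j + m) = ε * l j + c := fun j hj => h j (by omega)
  have h0 := h 0 (by omega)
  rw [zero_add] at h0
  rcases hε with rfl | rfl
  · -- Parallel halves: the walk crosses an interval and its translate by `c`.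
    rcases lt_trichotomy c 0 with hc0 | rfl | hc0
    · obtain ⟨k, hk1, hk2, hk⟩ := hsq (l 0 + 2 * c + 1) (-c) (by omega)
      obtain ⟨i, him, hi⟩ := exists_eq_of_ge_of_ge hl' (v := k - c) (by omega) (by omega)
      have him : i < m := lt_of_le_of_ne him (by rintro rfl; omega)
      refine absurd (hc i him) ?_
      rw [h i him, hi, show 1 * (k - c) + c = k by ring]
      exact fun e => hk e.symm
    · exact ⟨0, by omega, by rw [zero_add, h0]; simp⟩
    · obtain ⟨k, hk1, hk2, hk⟩ := hsq (l 0) c hc0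
      obtain ⟨i, him, hi⟩ := exists_eq_of_le_of_le hl' (v := k) (by omega) (by omega)
      have him : i < m := lt_of_le_of_ne him (by rintro rfl; omega)
      refine absurd (hc i him) ?_
      rwa [h i him, hi, one_mul]
  · -- Mirrored halves: the walk meets the centre `c / 2` of the reflection.
    obtain ⟨i, him, hi⟩ : ∃ i ≤ m, l i = c / 2 := by
      rcases le_or_gt (l 0) (c / 2) with h2 | h2
      · exact exists_eq_of_le_of_le hl' h2 (by omega)
      · exact exists_eq_of_ge_of_ge hl' h2.le (by omega)
    rcases him.lt_or_eq with him | rfl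
    · exact ⟨i, him, by rw [h i him, abs_le]; constructor <;> omega⟩
    · exact ⟨0, by omega, by rw [zero_add, abs_le]; constructor <;> omega⟩

/-! ### Layered labellings of paths -/

/-- The label that a vertex of an online path receives on its arrival. -/
structure VertexLabel where
  /-- The position on a line along which the current path runs from left to right. -/
  place : ℚ
  /-- One more than the least level of the neighbors on arrival; `0` for the first vertex. -/
  level : ℤ
  /-- The position in a run, that is, among the vertices of the same level that are not separated
  by a vertex of a lower level. -/
  index : ℤ

instance : Inhabited VertexLabel := ⟨⟨0, 0, 0⟩⟩

/-- The graph `G` is a path in the order of the places; levels of neighbors differ by at most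
one; and the indices count, from left to right, the vertices of a level that are not separated
by a vertex of a lower level. -/
structure IsLayered {V : Type*} (G : SimpleGraph V) (f : V → VertexLabel) : Prop where
  place_inj : ∀ u v, (f u).place = (f v).place → u = v
  adj_iff : ∀ u v, (f u).place < (f v).place →
    (G.Adj u v ↔ ∀ w, ¬ ((f u).place < (f w).place ∧ (f w).place < (f v).place))
  level_adj : ∀ u v, G.Adj u v → |(f v).level - (f u).level| ≤ 1
  index_succ : ∀ u v, (f u).place < (f v).place → (f u).level = (f v).level →
    (∀ w, (f u).place < (f w).place → (f w).place < (f v).place →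
      (f u).level < (f w).level) → (f v).index = (f u).index + 1

/-- The color of a vertex: one of four letters for its level, one of three for its index. -/
def VertexLabel.color (s : VertexLabel) : Fin 12 :=
  finProdFinEquiv (m := 4) (n := 3) (spacedThue s.level, ternaryThue s.index)

theorem VertexLabel.color_eq_iff {s s' : VertexLabel} : s.color = s'.color ↔
    spacedThue s.level = spacedThue s'.level ∧ ternaryThue s.index = ternaryThue s'.index := by
  rw [color, color, finProdFinEquiv.injective.eq_iff, Prod.mk.injEq]

/-- Along a left-to-right stretch of the path there is no repetition of colors: by
`walk_repeats` the levels repeat, hence so does the pattern of vertices of minimal level; these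
have consecutive indices, so that the ternary Thue sequence would contain a square. -/
theorem IsLayered.color_ne_of_increasing {V : Type*} {G : SimpleGraph V} {f : V → VertexLabel}
    (h : IsLayered G f) {u : ℕ → V} {m : ℕ} (hm : 0 < m)
    (hadj : ∀ j, j + 1 < 2 * m → G.Adj (u j) (u (j + 1)))
    (hlt : ∀ j, j + 1 < 2 * m → (f (u j)).place < (f (u (j + 1))).place)
    (hc : ∀ j < m, (f (u j)).color = (f (u (j + m))).color) : False := by
  set l : ℕ → ℤ := fun j => (f (u j)).level with hl
  have hrep : ∀ j < m, l j = l (j + m) :=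
    walk_repeats isSquareFreeSeq_spacedThue (fun a b => spacedThue_injOn_near)
      (fun j hj => h.level_adj _ _ (hadj j hj))
      (fun j hj => (VertexLabel.color_eq_iff.1 (hc j hj)).1)
  have between : ∀ i j, i < j → j < 2 * m → (f (u i)).place < (f (u j)).place ∧
      ∀ w, (f (u i)).place < (f w).place → (f w).place < (f (u j)).place →
        ∃ k, i < k ∧ k < j ∧ w = u k := by
    intro i j hij
    induction j, hij using Nat.le_induction with
    | base =>
      intro hj
      exact ⟨hlt i hj, fun w h1 h2 =>
        absurd ⟨h1, h2⟩ ((h.adj_iff _ _ (hlt i hj)).1 (hadj i hj) w)⟩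
    | succ j hij ih =>
      intro hj
      obtain ⟨ih1, ih2⟩ := ih (by omega)
      refine ⟨ih1.trans (hlt j hj), fun w h1 h2 => ?_⟩
      rcases lt_trichotomy (f w).place (f (u j)).place with h3 | h3 | h3
      · obtain ⟨k, hk1, hk2, hk⟩ := ih2 w h1 h3
        exact ⟨k, hk1, by omega, hk⟩
      · exact ⟨j, hij, by omega, h.place_inj _ _ h3⟩
      · exact absurd ⟨h3, h2⟩ ((h.adj_iff _ _ (hlt j hj)).1 (hadj j hj) w)
  obtain ⟨k₀, hk₀, hmin⟩ := Finset.exists_min_image (Finset.range m) l ⟨0, by simpa using hm⟩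
  simp only [Finset.mem_range] at hk₀ hmin
  -- The positions of minimal level, continued periodically to an infinite set.
  let P : ℕ → Prop := fun j => l (j % m) = l k₀
  have hlmod : ∀ j < 2 * m, l j = l (j % m) := by
    intro j hj
    rcases lt_or_ge j m with h1 | h1
    · rw [Nat.mod_eq_of_lt h1]
    · obtain ⟨i, rfl⟩ := Nat.exists_eq_add_of_le' h1
      rw [Nat.add_mod_right, Nat.mod_eq_of_lt (by omega), hrep i (by omega)]
  have hinf : (Set.ofPred P).Infinite := by
    refine Set.infinite_of_forall_exists_gt fun a => ⟨k₀ + m * (a + 1), ?_, ?_⟩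
    · change l ((k₀ + m * (a + 1)) % m) = l k₀
      rw [Nat.add_mul_mod_self_left, Nat.mod_eq_of_lt hk₀]
    · nlinarith
  classical
  have hPm : ∀ j, P (m + j) ↔ P j := fun j => by simp [P]
  have hcount : ∀ a, Nat.count P (m + a) = Nat.count P m + Nat.count P a := by
    intro a
    rw [Nat.count_add]
    simp only [hPm]
  set K := Nat.count P m with hK
  have hK0 : 0 < K := by
    have := Nat.count_strict_mono (p := P) (m := k₀) (n := m)
      (by change l (k₀ % m) = _; rw [Nat.mod_eq_of_lt hk₀]) hk₀
    omega
  have hnth : ∀ r < 2 * K, Nat.nth P r < 2 * m := fun r hr =>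
    Nat.nth_lt_of_lt_count (by rw [two_mul m, hcount]; omega)
  have hlev : ∀ r < 2 * K, l (Nat.nth P r) = l k₀ := fun r hr => by
    rw [hlmod _ (hnth r hr)]
    exact Nat.nth_mem_of_infinite hinf r
  have hidx : ∀ r < 2 * K, (f (u (Nat.nth P r))).index = (f (u (Nat.nth P 0))).index + r := by
    intro r
    induction r with
    | zero => simp
    | succ r ih =>
      intro hr
      have hlt := Nat.nth_strictMono hinf (Nat.lt_succ_self r)
      obtain ⟨h1, h2⟩ := between _ _ hlt (hnth _ hr)
      rw [h.index_succ _ _ h1 ((hlev r (by omega)).trans (hlev _ hr).symm), ih (by omega)]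
      · push_cast; ring
      · intro w hw1 hw2
        obtain ⟨k, hk1, hk2, rfl⟩ := h2 w hw1 hw2
        have hk := hk2.trans (hnth _ hr)
        change l (Nat.nth P r) < l k
        rw [hlev r (by omega)]
        refine lt_of_le_of_ne ?_ fun e => ?_
        · rw [hlmod k hk]
          exact hmin _ (Nat.mod_lt _ hm)
        · have hPk : P k := by change l (k % m) = _; rw [← hlmod k hk, e]
          have c1 := Nat.count_strict_mono (Nat.nth_mem_of_infinite hinf r) hk1
          have c2 := Nat.count_strict_mono hPk hk2
          rw [Nat.count_nth_of_infinite hinf] at c1 c2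
          omega
  have hshift : ∀ r, Nat.nth P (r + K) = Nat.nth P r + m := by
    intro r
    have h1 : P (Nat.nth P r + m) := by
      rw [add_comm, hPm]
      exact Nat.nth_mem_of_infinite hinf r
    rw [← Nat.nth_count h1, add_comm _ m, hcount, Nat.count_nth_of_infinite hinf, add_comm K]
  obtain ⟨k, hk1, hk2, hk⟩ :=
    isSquareFreeSeq_ternaryThue (f (u (Nat.nth P 0))).index K (by omega)
  obtain ⟨r, rfl⟩ : ∃ r : ℕ, k = (f (u (Nat.nth P 0))).index + r :=
    ⟨(k - (f (u (Nat.nth P 0))).index).toNat, by omega⟩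
  have hr : r < K := by omega
  have hcol := (VertexLabel.color_eq_iff.1 (hc (Nat.nth P r) (Nat.nth_lt_of_lt_count hr))).2
  rw [← hshift, hidx r (by omega), hidx (r + K) (by omega)] at hcol
  apply hk
  rw [hcol]
  push_cast
  ring_nf

/-- The coloring of a layered path is nonrepetitive: a path in `G` runs from left to right or
from right to left; in the latter case it is reversed. -/
theorem IsLayered.isNonrepetitiveColoring {V : Type*} {G : SimpleGraph V} {f : V → VertexLabel}
    (h : IsLayered G f) : IsNonrepetitiveColoring G (fun v => (f v).color) := by
  rintro x y p hp ⟨w, hw, hrep⟩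
  set m := w.length with hm
  have hm0 : 0 < m := List.length_pos_iff.2 hw
  have hlen : p.length + 1 = 2 * m := by
    have := congrArg List.length hrep
    simpa [← two_mul] using this
  set u := p.getVert with hu
  have hadj : ∀ j, j + 1 < 2 * m → G.Adj (u j) (u (j + 1)) := fun j hj =>
    p.adj_getVert_succ (by omega)
  have hcol : ∀ j < 2 * m, (p.support.map fun v => (f v).color)[j]? = some (f (u j)).color := by
    intro j hj
    rw [List.getElem?_map, hu, ← p.getVert_eq_support_getElem? (by omega)]
    rfl
  have hc : ∀ j < m, (f (u j)).color = (f (u (j + m))).color := by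
    intro j hj
    apply Option.some_injective
    rw [← hcol j (by omega), ← hcol (j + m) (by omega), hrep, List.getElem?_append_left hj,
      List.getElem?_append_right (by omega), ← hm, Nat.add_sub_cancel]
  have hinj : ∀ i j, i < 2 * m → j < 2 * m → u i = u j → i = j := fun i j hi hj e =>
    hp.getVert_injOn (by simp; omega) (by simp; omega) e
  have hne : ∀ j, j + 1 < 2 * m → (f (u j)).place ≠ (f (u (j + 1))).place := fun j hj e =>
    (hadj j hj).ne (h.place_inj _ _ e)
  -- Two neighbors on the same side of a vertex coincide.
  have hdir : ∀ j, j + 2 < 2 * m → ((f (u j)).place < (f (u (j + 1))).place ↔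
      (f (u (j + 1))).place < (f (u (j + 2))).place) := by
    intro j hj
    have a1 := hadj j (by omega)
    have a2 := hadj (j + 1) hj
    have n1 := hne j (by omega)
    have n2 := hne (j + 1) hj
    have n3 : (f (u j)).place ≠ (f (u (j + 2))).place := fun e =>
      absurd (hinj _ _ (by omega) hj (h.place_inj _ _ e)) (by omega)
    constructor <;> intro h1 <;> by_contra h2
    · replace h2 := lt_of_le_of_ne (not_lt.1 h2) n2.symm
      have b1 := (h.adj_iff _ _ h1).1 a1 (u (j + 2))
      have b2 := (h.adj_iff _ _ h2).1 a2.symm (u j)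
      rcases lt_or_gt_of_ne n3 with h3 | h3
      · exact b1 ⟨h3, h2⟩
      · exact b2 ⟨h3, h1⟩
    · replace h2 := lt_of_le_of_ne (not_lt.1 h2) n1.symm
      have b1 := (h.adj_iff _ _ h2).1 a1.symm (u (j + 2))
      have b2 := (h.adj_iff _ _ h1).1 a2 (u j)
      rcases lt_or_gt_of_ne n3 with h3 | h3
      · exact b2 ⟨h2, h3⟩
      · exact b1 ⟨h1, h3⟩
  have hdir' : ∀ j, j + 1 < 2 * m →
      ((f (u j)).place < (f (u (j + 1))).place ↔ (f (u 0)).place < (f (u 1)).place) := by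
    intro j
    induction j with
    | zero => simp
    | succ j ih =>
      intro hj
      rw [← hdir j hj, ih (by omega)]
  by_cases h01 : (f (u 0)).place < (f (u 1)).place
  · exact h.color_ne_of_increasing hm0 hadj (fun j hj => (hdir' j hj).2 h01) hc
  · refine h.color_ne_of_increasing (u := fun j => u (2 * m - 1 - j)) hm0 ?_ ?_ ?_
    · intro j hj
      have := (hadj (2 * m - 1 - (j + 1)) (by omega)).symm
      rwa [show 2 * m - 1 - (j + 1) + 1 = 2 * m - 1 - j by omega] at this
    · intro j hj
      have h1 := hne (2 * m - 1 - (j + 1)) (by omega)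
      have h2 := mt (hdir' (2 * m - 1 - (j + 1)) (by omega)).1 h01
      rw [show 2 * m - 1 - (j + 1) + 1 = 2 * m - 1 - j by omega] at h1 h2
      exact lt_of_le_of_ne (not_lt.1 h2) h1.symm
    · intro j hj
      have := (hc (m - 1 - j) (by omega)).symm
      rwa [show m - 1 - j + m = 2 * m - 1 - j by omega,
        show m - 1 - j = 2 * m - 1 - (j + m) by omega] at this

/-! ### Labelling the new vertex -/

theorem nextGraph_adj_castSucc {t : ℕ} {G : SimpleGraph (Fin (t + 1))} {D : Set (Fin (t + 1))}
    {C : Set (Sym2 (Fin (t + 1)))} {u v : Fin (t + 1)} :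
    (nextGraph G D C).Adj u.castSucc v.castSucc ↔ G.Adj u v ∧ s(u, v) ∉ C := by
  have hinj : Function.Injective (Sym2.map (Fin.castSucc (n := t + 1))) :=
    Sym2.map.injective (Fin.castSucc_injective _)
  have hne : ∀ d ∈ D, s(Fin.last (t + 1), d.castSucc) ≠ s(u.castSucc, v.castSucc) := by
    intro d _ e
    rcases Sym2.eq_iff.1 e with ⟨h, -⟩ | ⟨h, -⟩
    · exact Fin.castSucc_ne_last _ h.symm
    · exact Fin.castSucc_ne_last _ h.symm
  have hmem : ∀ A : Set (Sym2 (Fin (t + 1))),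
      s(u.castSucc, v.castSucc) ∈ Sym2.map Fin.castSucc '' A ↔ s(u, v) ∈ A := fun A => by
    rw [← Sym2.map_mk, hinj.mem_set_image]
  rw [nextGraph, SimpleGraph.fromEdgeSet_adj, Set.mem_sdiff, Set.mem_union, hmem, hmem,
    SimpleGraph.mem_edgeSet]
  constructor
  · rintro ⟨⟨h | ⟨d, hd, e⟩, hC⟩, -⟩
    · exact ⟨h, hC⟩
    · exact absurd e (hne d hd)
  · rintro ⟨h, hC⟩
    exact ⟨⟨Or.inl h, hC⟩, fun e => h.ne (Fin.castSucc_injective _ e)⟩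

theorem nextGraph_adj_last {t : ℕ} {G : SimpleGraph (Fin (t + 1))} {D : Set (Fin (t + 1))}
    {C : Set (Sym2 (Fin (t + 1)))} {u : Fin (t + 1)} :
    (nextGraph G D C).Adj (Fin.last (t + 1)) u.castSucc ↔ u ∈ D := by
  have hne : ∀ A : Set (Sym2 (Fin (t + 1))),
      s(Fin.last (t + 1), u.castSucc) ∉ Sym2.map Fin.castSucc '' A := by
    rintro A ⟨e, -, he⟩
    induction e using Sym2.ind with
    | _ x y =>
      rw [Sym2.map_mk] at he
      rcases Sym2.eq_iff.1 he with ⟨h, -⟩ | ⟨-, h⟩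
      · exact Fin.castSucc_ne_last _ h
      · exact Fin.castSucc_ne_last _ h
  rw [nextGraph, SimpleGraph.fromEdgeSet_adj, Set.mem_sdiff, Set.mem_union]
  constructor
  · rintro ⟨⟨h | ⟨d, hd, e⟩, -⟩, -⟩
    · exact absurd h (hne _)
    · rcases Sym2.eq_iff.1 e with ⟨-, h⟩ | ⟨h, -⟩
      · rwa [← Fin.castSucc_injective _ h]
      · exact absurd h.symm (Fin.castSucc_ne_last _)
  · intro h
    exact ⟨⟨Or.inr ⟨u, h, rfl⟩, hne _⟩, (Fin.castSucc_ne_last _).symm⟩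

/-- The labelling `f` of the old vertices, extended by the label `s` of the new vertex. -/
def extendLabelling {t : ℕ} (f : Fin (t + 1) → VertexLabel) (s : VertexLabel) :
    Fin (t + 1 + 1) → VertexLabel :=
  Fin.snoc (α := fun _ => VertexLabel) f s

@[simp] theorem extendLabelling_castSucc {t : ℕ} (f : Fin (t + 1) → VertexLabel)
    (s : VertexLabel) (i : Fin (t + 1)) : extendLabelling f s i.castSucc = f i := by
  simp [extendLabelling]

@[simp] theorem extendLabelling_last {t : ℕ} (f : Fin (t + 1) → VertexLabel)
    (s : VertexLabel) : extendLabelling f s (Fin.last (t + 1)) = s := by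
  simp [extendLabelling]

theorem forall_fin_castSucc_last {t : ℕ} {P : Fin (t + 1 + 1) → Prop} :
    (∀ i, P i) ↔ (∀ i : Fin (t + 1), P i.castSucc) ∧ P (Fin.last (t + 1)) :=
  Fin.forall_fin_succ'

/-- The label of the mirror image. -/
def VertexLabel.mirror (s : VertexLabel) : VertexLabel := ⟨-s.place, s.level, -s.index⟩

theorem VertexLabel.mirror_mirror (s : VertexLabel) : s.mirror.mirror = s := by
  simp [mirror]

theorem IsLayered.mirror {V : Type*} {G : SimpleGraph V} {f : V → VertexLabel}
    (h : IsLayered G f) : IsLayered G (fun v => (f v).mirror) where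
  place_inj u v e := h.place_inj u v (neg_injective e)
  adj_iff u v huv := by
    have huv' : (f v).place < (f u).place := neg_lt_neg_iff.1 huv
    rw [G.adj_comm, h.adj_iff v u huv']
    simp only [VertexLabel.mirror, neg_lt_neg_iff]
    exact forall_congr' fun w => not_congr and_comm
  level_adj := h.level_adj
  index_succ u v huv hl hw := by
    have huv' : (f v).place < (f u).place := neg_lt_neg_iff.1 huv
    have := h.index_succ v u huv' hl.symm fun w h1 h2 => by
      rw [show (f v).level = (f u).level from hl.symm]
      exact hw w (neg_lt_neg_iff.2 h2) (neg_lt_neg_iff.2 h1)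
    simp only [VertexLabel.mirror]
    omega

/-- Between neighbors `a` and `b` the new vertex gets one more than the lower of the two levels.
If the levels of `a` and `b` differ, then the new vertex extends the run of the higher one by one
vertex on the left or on the right; otherwise it starts a run. -/
theorem IsLayered.exists_subdivide {t : ℕ} {G : SimpleGraph (Fin (t + 1))}
    {f : Fin (t + 1) → VertexLabel} (h : IsLayered G f) {a b : Fin (t + 1)} (hab : G.Adj a b)
    (hlt : (f a).place < (f b).place) :
    ∃ s, IsLayered (nextGraph G {a, b} {s(a, b)}) (extendLabelling f s) := by
  have hbetween : ∀ w, (f w).place ≤ (f a).place ∨ (f b).place ≤ (f w).place := fun w => by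
    have := (h.adj_iff a b hlt).1 hab w
    by_contra! h'
    exact this h'
  obtain ⟨x, hax, hxb⟩ := exists_between hlt
  have hlev := abs_le.1 (h.level_adj a b hab)
  have hleft : ∀ w, (f w).place < x ↔ (f w).place ≤ (f a).place := fun w =>
    ⟨fun hw => (hbetween w).resolve_right fun h' => by linarith, fun hw => by linarith⟩
  have hright : ∀ w, x < (f w).place ↔ (f b).place ≤ (f w).place := fun w =>
    ⟨fun hw => (hbetween w).resolve_left fun h' => by linarith, fun hw => by linarith⟩
  refine ⟨⟨x, 1 + min (f a).level (f b).level,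
    if (f b).level < (f a).level then (f a).index + 1 else (f b).index - 1⟩, ?_, ?_, ?_, ?_⟩
  · simp only [forall_fin_castSucc_last, extendLabelling_castSucc, extendLabelling_last,
      Fin.castSucc_inj]
    refine ⟨fun u => ⟨h.place_inj u, fun e => ?_⟩, fun v e => ?_, fun _ => trivial⟩
    · rcases hbetween u with h' | h' <;> linarith
    · rcases hbetween v with h' | h' <;> linarith
  · simp only [forall_fin_castSucc_last, extendLabelling_castSucc, extendLabelling_last,
      nextGraph_adj_castSucc, SimpleGraph.adj_comm _ _ (Fin.last _), nextGraph_adj_last,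
      Set.mem_singleton_iff, Set.mem_insert_iff, hleft, hright, lt_irrefl, false_and, and_false,
      not_false_eq_true, and_true, false_imp_iff]
    refine ⟨fun u => ⟨fun v huv => ?_, fun hu => ?_⟩, fun v hv => ?_⟩
    · rw [h.adj_iff u v huv]
      refine and_congr_right fun hw => ?_
      rw [not_iff_not, Sym2.eq_iff]
      constructor
      · rintro (⟨rfl, rfl⟩ | ⟨rfl, rfl⟩)
        · exact ⟨le_rfl, le_rfl⟩
        · linarith
      · rintro ⟨h1, h2⟩
        left
        constructor
        · refine h.place_inj _ _ (le_antisymm h1 (not_lt.1 fun h' => hw a ⟨h', ?_⟩))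
          linarith
        · refine h.place_inj _ _ (le_antisymm (not_lt.1 fun h' => hw b ⟨?_, h'⟩) h2)
          linarith
    · constructor
      · rintro (rfl | rfl) w ⟨h1, h2⟩ <;> linarith
      · intro hw
        exact Or.inl (h.place_inj _ _ (le_antisymm hu (not_lt.1 fun h' => hw a ⟨h', le_rfl⟩)))
    · constructor
      · rintro (rfl | rfl) w ⟨h1, h2⟩ <;> linarith
      · intro hw
        exact Or.inr (h.place_inj _ _ (le_antisymm (not_lt.1 fun h' => hw b ⟨le_rfl, h'⟩) hv))
  · simp only [forall_fin_castSucc_last, extendLabelling_castSucc, extendLabelling_last,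
      nextGraph_adj_castSucc, SimpleGraph.adj_comm _ _ (Fin.last _), nextGraph_adj_last,
      Set.mem_singleton_iff, Set.mem_insert_iff, SimpleGraph.irrefl, false_imp_iff, and_true]
    refine ⟨fun u => ⟨fun v huv => h.level_adj u v huv.1, ?_⟩, ?_⟩
    · rintro (rfl | rfl) <;> rw [abs_le] <;> omega
    · rintro v (rfl | rfl) <;> rw [abs_le] <;> omega
  · simp only [forall_fin_castSucc_last, extendLabelling_castSucc, extendLabelling_last,
      hleft, hright, lt_irrefl, false_imp_iff, and_true]
    refine ⟨fun u => ⟨fun v huv e hw => h.index_succ u v huv e hw.1, fun hu e hw => ?_⟩,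
      fun v hv e hw => ?_⟩
    · -- A run that reaches the new vertex from the left does so from `a`.
      obtain rfl : u = a := by
        by_contra hne
        have := hw.1 a (lt_of_le_of_ne hu fun e => hne (h.place_inj _ _ e)) le_rfl
        omega
      rw [if_pos (by omega)]
    · obtain rfl : v = b := by
        by_contra hne
        have := hw b le_rfl (lt_of_le_of_ne hv fun e => hne (h.place_inj _ _ e.symm))
        omega
      rw [if_neg (by omega)]
      ring

/-- Appended to the right of the rightmost vertex `e`, the new vertex gets a level above that of
`e` and starts a run. -/
theorem IsLayered.exists_append_right {t : ℕ} {G : SimpleGraph (Fin (t + 1))}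
    {f : Fin (t + 1) → VertexLabel} (h : IsLayered G f) {e : Fin (t + 1)}
    (he : ∀ w, (f w).place ≤ (f e).place) :
    ∃ s, IsLayered (nextGraph G {e} ∅) (extendLabelling f s) := by
  have hlt : ∀ w, (f w).place < (f e).place + 1 := fun w => by linarith [he w]
  refine ⟨⟨(f e).place + 1, (f e).level + 1, 0⟩, ?_, ?_, ?_, ?_⟩
  · simp only [forall_fin_castSucc_last, extendLabelling_castSucc, extendLabelling_last,
      Fin.castSucc_inj]
    exact ⟨fun u => ⟨h.place_inj u, fun e' => absurd e' (hlt u).ne⟩,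
      fun v e' => absurd e' (hlt v).ne', fun _ => trivial⟩
  · simp only [forall_fin_castSucc_last, extendLabelling_castSucc, extendLabelling_last,
      nextGraph_adj_castSucc, SimpleGraph.adj_comm _ _ (Fin.last _), nextGraph_adj_last,
      Set.mem_singleton_iff, hlt, (hlt _).not_gt, lt_irrefl, false_and, and_false,
      not_false_eq_true, and_true, false_imp_iff, Set.mem_empty_iff_false, implies_true,
      true_imp_iff]
    refine fun u => ⟨fun v huv => h.adj_iff u v huv, ?_, fun hw => ?_⟩
    · rintro rfl w
      exact not_lt.2 (he w)
    · exact h.place_inj _ _ (le_antisymm (he u) (not_lt.1 (hw e)))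
  · simp only [forall_fin_castSucc_last, extendLabelling_castSucc, extendLabelling_last,
      nextGraph_adj_castSucc, SimpleGraph.adj_comm _ _ (Fin.last _), nextGraph_adj_last,
      Set.mem_singleton_iff, SimpleGraph.irrefl, false_imp_iff, and_true]
    refine ⟨fun u => ⟨fun v huv => h.level_adj u v huv.1, ?_⟩, ?_⟩
    · rintro rfl
      rw [abs_le]; omega
    · rintro v rfl
      rw [abs_le]; omega
  · simp only [forall_fin_castSucc_last, extendLabelling_castSucc, extendLabelling_last,
      hlt, (hlt _).not_gt, lt_irrefl, false_imp_iff, and_true, implies_true, true_imp_iff]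
    refine fun u => ⟨fun v huv e' hw => h.index_succ u v huv e' hw, fun e' hw => ?_⟩
    have hne : u ≠ e := by
      rintro rfl
      omega
    have := hw e (lt_of_le_of_ne (he u) fun e' => hne (h.place_inj _ _ e'))
    omega

/-- A vertex of the path with at most one neighbor is leftmost or rightmost. -/
theorem IsLayered.extreme_of_subsingleton {V : Type*} [Finite V] {G : SimpleGraph V}
    {f : V → VertexLabel} (h : IsLayered G f) {e : V} (he : (G.neighborSet e).Subsingleton) :
    (∀ w, (f w).place ≤ (f e).place) ∨ ∀ w, (f e).place ≤ (f w).place := by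
  by_contra! hcon
  obtain ⟨⟨b, hb⟩, a, ha⟩ := hcon
  obtain ⟨b', hb1, hb2⟩ := Set.exists_min_image {w | (f e).place < (f w).place}
    (fun w => (f w).place) (Set.toFinite _) ⟨b, hb⟩
  obtain ⟨a', ha1, ha2⟩ := Set.exists_max_image {w | (f w).place < (f e).place}
    (fun w => (f w).place) (Set.toFinite _) ⟨a, ha⟩
  have hadjb : G.Adj e b' := (h.adj_iff _ _ hb1).2 fun w hw => absurd hw.2 (not_lt.2 (hb2 w hw.1))
  have hadja : G.Adj a' e := (h.adj_iff _ _ ha1).2 fun w hw => absurd hw.1 (not_lt.2 (ha2 w hw.2))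
  have := he hadja.symm hadjb
  subst this
  exact lt_asymm (Set.mem_ofPred.1 ha1) hb1

theorem IsLayered.exists_extend {t : ℕ} {G : SimpleGraph (Fin (t + 1))}
    {f : Fin (t + 1) → VertexLabel} (h : IsLayered G f) {D : Set (Fin (t + 1))}
    {C : Set (Sym2 (Fin (t + 1)))} (hmove : onlinePath t G D C) :
    ∃ s, IsLayered (nextGraph G D C) (extendLabelling f s) := by
  obtain ⟨-, ⟨e, he, rfl, rfl⟩ | ⟨a, b, hab, rfl, rfl⟩⟩ := hmove
  · rcases h.extreme_of_subsingleton he with hmax | hmin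
    · exact h.exists_append_right hmax
    · obtain ⟨s, hs⟩ := h.mirror.exists_append_right (e := e) fun w => neg_le_neg (hmin w)
      refine ⟨s.mirror, ?_⟩
      convert hs.mirror using 1
      ext1 v
      refine Fin.lastCases ?_ (fun v => ?_) v
      · simp
      · simp [VertexLabel.mirror_mirror]
  · rcases lt_or_gt_of_ne fun e => hab.ne (h.place_inj a b e) with hlt | hlt
    · exact h.exists_subdivide hab hlt
    · rw [Set.pair_comm, Sym2.eq_swap]
      exact h.exists_subdivide hab.symm hlt

/-! ### The strategy -/

/-- The labels given by the greedy strategy along the process `G`: each new vertex gets some label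
that keeps the labelling layered. -/
noncomputable def processLabelling (G : ∀ t : ℕ, SimpleGraph (Fin (t + 1))) :
    ∀ t : ℕ, Fin (t + 1) → VertexLabel
  | 0 => fun _ => default
  | t + 1 => extendLabelling (processLabelling G t) <|
      Classical.epsilon fun s => IsLayered (G (t + 1)) (extendLabelling (processLabelling G t) s)

theorem processLabelling_congr {G G' : ∀ t : ℕ, SimpleGraph (Fin (t + 1))} (t : ℕ)
    (h : ∀ s ≤ t, G s = G' s) : processLabelling G t = processLabelling G' t := by
  induction t with
  | zero => rfl
  | succ t ih =>
    rw [processLabelling, processLabelling, ih fun s hs => h s (by omega), h (t + 1) le_rfl]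

theorem processLabelling_eq_last (G : ∀ t : ℕ, SimpleGraph (Fin (t + 1))) (t : ℕ)
    (s : Fin (t + 1)) : processLabelling G t s = processLabelling G s.val (Fin.last s.val) := by
  induction t with
  | zero =>
    obtain rfl : s = Fin.last 0 := Fin.fin_one_eq_zero s
    rfl
  | succ t ih =>
    refine Fin.lastCases rfl (fun s => ?_) s
    rw [processLabelling, extendLabelling_castSucc, ih s]
    rfl

theorem isLayered_processLabelling {N : ℕ∞} {G : ∀ t : ℕ, SimpleGraph (Fin (t + 1))}
    (hG : IsOnlineProcess onlinePath N G) (t : ℕ) (ht : (t : ℕ∞) ≤ N) :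
    IsLayered (G t) (processLabelling G t) := by
  induction t with
  | zero =>
    have hsub : ∀ u v : Fin (0 + 1), u = v := fun u v =>
      (Fin.fin_one_eq_zero u).trans (Fin.fin_one_eq_zero v).symm
    exact ⟨fun u v _ => hsub u v, fun u v huv => absurd huv (by simp [hsub u v]),
      fun u v huv => absurd (hsub u v) huv.ne, fun u v huv => absurd huv (by simp [hsub u v])⟩
  | succ t ih =>
    obtain ⟨D, C, -, hmove, hnext⟩ := hG t ht
    have hle : (t : ℕ∞) ≤ N := le_trans (by exact_mod_cast Nat.le_succ t) ht
    have hex := (ih hle).exists_extend hmove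
    rw [← hnext] at hex
    exact Classical.epsilon_spec hex

/-- The vertex `v_t` gets the color of its label. The history is continued by empty graphs, on
which this label does not depend. -/
noncomputable def pathStrategy : OnlineStrategy (Fin 12) := fun t hist =>
  (processLabelling (fun s => if h : s < t + 1 then hist ⟨s, h⟩ else ⊥) t (Fin.last t)).color

theorem pathStrategy_coloring (G : ∀ t : ℕ, SimpleGraph (Fin (t + 1))) (t : ℕ) :
    pathStrategy.coloring G t = fun v => (processLabelling G t v).color := by
  funext v
  rw [OnlineStrategy.coloring, pathStrategy, processLabelling_eq_last G t v]
  rw [processLabelling_congr (G' := G) v.val fun s hs => dif_pos (by omega)]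

theorem theorem4 : OnlineNonrepetitivelyColorable onlinePath 12 := by
  refine ⟨pathStrategy, fun N G hG t ht => ?_⟩
  rw [pathStrategy_coloring]
  exact (isLayered_processLabelling hG t ht).isNonrepetitiveColoring
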